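/- Let $n\ge 0$ be an integer. (1) Words with a stop symbol. Let $p_0,p_1,\dots,p_n>0$ with $\sum_{i=0}^n p_i=1$. A word is a finite (possibly empty) sequence of letters from $\{1,\dots,n\}$ followed by the stop symbol $0$, and its probability is the product of the probabilities of its symbols, including the factor $p_0$. Assume that $\log p_i/\log p_j$ is irrational for some $i,j\in\{1,\dots,n\}$. Then the equation $\sum_{i=1}^n p_i^\gamma=1$ has exactly one real root $\gamma$, and $0<\gamma<1$. All words can be arranged in a list $w_1,w_2,\dots$, each word occurring exactly once, in non-increasing order of probability. For every such list, let $p(r)$ be the probability of $w_r$, and let $H(\mathbf p^\gamma)$ be the entropy of $(p_1^\gamma,\dots,p_n^\gamma)$, that is, $H(\mathbf p^\gamma)=-\sum_{i=1}^n p_i^\gamma\ln p_i^\gamma=-\gamma\sum_{i=1}^n p_i^\gamma\ln p_i$. Then $H(\mathbf p^\gamma)>0$ and $$\lim_{r\to\infty}\frac{(p(r)/p_0)^{-\gamma}}{r}=H(\mathbf p^\gamma),\qquad \lim_{r\to\infty}\frac{p(r)}{r^{-1/\gamma}}=p_0\,H(\mathbf p^\gamma)^{-1/\gamma}.$$ (2)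 The case $\gamma=1$, without a stop symbol. Let $p_1,\dots,p_n>0$ with $\sum_{i=1}^n p_i=1$, and assume that $\log p_i/\log p_j$ is irrational for some $i,j$. Consider all finite words over $\{1,\dots,n\}$, including the empty one, where the probability of a word is the product of the probabilities of its letters ($1$ for the empty word). All words can be arranged in a list, each occurring exactly once, in non-increasing order of probability. Let $H(\mathbf p)=-\sum_{i=1}^n p_i\ln p_i$. Then $H(\mathbf p)>0$, and for every such list the probability $p(r)$ of its $r$-th word satisfies $$\lim_{r\to\infty}\frac{p(r)}{r^{-1}}=H(\mathbf p)^{-1}.$$ (3) The multinomial form. Let $a_1,\dots,a_n>0$ be such that $a_i/a_j$ is irrational for some $i,j$ and $\sum_{i=1}^n p_i=1$, where $p_i=e^{-a_i}$. Then $$\lim_{z\to\infty} e^{-z}\sum_{\mathbf k}\frac{(k_1+\dots+k_n)!}{k_1!\cdots k_n!}=\Big(\sum_{i=1}^n a_i p_i\Big)^{-1},$$ where the sum is over all $\mathbf k\in\mathbb Z^n$ with $k_1,\dots,k_n\ge 0$ and $\sum_{i=1}^n a_i k_i\le z$. -/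

import Mathlib

open Filter Topology

noncomputable section

namespace Monkey

/-- The probability of a finite sequence of independent symbols: the product of the
probabilities of its symbols (it is `1` for the empty sequence). -/
def seqProb {S : Type} (p : S → ℝ) (l : List S) : ℝ :=
  (l.map p).prod

/-- The symbols are `0, 1, …, n`, and `0` is the stop symbol. The word with the letters `u`
is `u` (with the `i`-th of the `n` letters written as the symbol `i.succ`) followed by the stop
symbol, which occurs nowhere else. -/
def withStop {n : ℕ} (u : List (Fin n)) : List (Fin (n + 1)) :=
  u.map Fin.succ ++ [0]

/-- `w 1, w 2, w 3, …` is a list of all elements of `W`, each occurring exactly once, in the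
non-increasing order of `prob`; `w r` is the element of rank `r`. (The value `w 0` is not part of
the list.) -/
def IsRanking {W : Type} (prob : W → ℝ) (w : ℕ → W) : Prop :=
  Set.BijOn w (Set.Ici 1) Set.univ ∧ AntitoneOn (fun r => prob (w r)) (Set.Ici 1)

/-- The entropy `-∑ qᵢ ln qᵢ`. -/
def entropy {n : ℕ} (q : Fin n → ℝ) : ℝ :=
  - ∑ i, q i * Real.log (q i)

/-- The simplex `{x : x ≥ 0, ∑ aᵢ xᵢ ≤ z}`. -/
def simplex {n : ℕ} (a : Fin n → ℝ) (z : ℝ) : Set (Fin n → ℝ) :=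
  {x | (∀ i, 0 ≤ x i) ∧ ∑ i, a i * x i ≤ z}

/-- The integer points of the simplex. -/
def latticePoints {n : ℕ} (a : Fin n → ℝ) (z : ℝ) : Set (Fin n → ℕ) :=
  {k | (fun i => (k i : ℝ)) ∈ simplex a z}

/-- The set summed over in `multinomialSum` is finite. -/
theorem finite_latticePoints {n : ℕ} {a : Fin n → ℝ} (ha : ∀ i, 0 < a i) (z : ℝ) :
    (latticePoints a z).Finite := by
  refine (Set.finite_Iic (fun i => ⌊z / a i⌋₊)).subset fun k hk i => ?_
  refine Nat.le_floor ?_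
  rw [le_div_iff₀ (ha i), mul_comm]
  refine le_trans ?_ hk.2
  exact Finset.single_le_sum (f := fun i => a i * (k i : ℝ))
    (fun j _ => mul_nonneg (ha j).le (Nat.cast_nonneg _)) (Finset.mem_univ i)

/-- The sum of the multinomial coefficients `(k₁ + ⋯ + kₙ)! / (k₁! ⋯ kₙ!)` over the integer
points of the simplex. -/
def multinomialSum {n : ℕ} (a : Fin n → ℝ) (z : ℝ) : ℝ :=
  ∑ᶠ k ∈ latticePoints a z, (Nat.multinomial Finset.univ k : ℝ)

end Monkey

end

/-!
All three parts reduce to one count. Let the letter `i` cost `a i > 0`, where `∑ e ^ (-a i) = 1`, and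
let `N z` be the number of words of cost at most `z`; then `N z ∼ e ^ z / ∑ a i e ^ (-a i)`
(`tendsto_wordCount`). For part (1) the costs are `-γ log p i`, for part (2) `-log p i`. A word of
rank `r` and cost `c` satisfies `N (c - ε) ≤ r ≤ N c`, so that `r ∼ N c`
(`tendsto_natCast_div_exp_rank`). For part (3), the multinomial coefficient counts the words with
given multiplicities of the letters (`ncard_words_count_eq`), so the sum is `N z` itself.

Splitting off the first letter gives `N z = 1 + ∑ N (z - a i)` for `z ≥ 0`. With `n` letters and
`c = 1 / (n - 1)`, the function `h z = e ^ (-z) (N z + c)` therefore satisfies the homogeneous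
renewal equation `h z = ∑ p i h (z - a i)` for `z ≥ 0`, where `p i = e ^ (-a i)`. It is bounded by
the maximum principle, and decreases at most exponentially because `N` is monotone.

The limit of `h` is found by an elementary proof of the renewal theorem (`tendsto_of_renewal`). Take
a filter along which `h` tends to its upper limit `L`. As `h z` is an average of the `h (z - a i)`,
these tend to `L` as well, and hence so does `h (z - s)` for each `s` in the semigroup generated by
the `a i`. Two of the `a i` have an irrational quotient, so the semigroup is eventually `η`-dense for
every `η > 0`; hence `h` is uniformly close to `L` on arbitrarily long intervals
(`exists_eventually_forall_Icc`). On the other hand `∑ p i ∫_{z - a i}^z h` does not depend on `z`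
(`sum_mul_integral_eq`), and on such an interval it is close to `L ∑ p i a i`. This determines `L`.
The same applies to the lower limit, so the two agree.
-/

namespace Monkey

/-! ### Numerical semigroups generated by incommensurable reals -/

/-- The semigroup generated by two reals `a > 0` and `b` with irrational quotient becomes arbitrarily
dense far out. -/
theorem exists_forall_ge_natCast_mul_add_mem_Ico {a b : ℝ} (ha : 0 < a)
    (hab : Irrational (a / b)) {η : ℝ} (hη : 0 < η) :
    ∃ S : ℝ, ∀ x, S ≤ x → ∃ m k : ℕ, x ≤ m * a + k * b ∧ m * a + k * b < x + η := by
  obtain ⟨d, hd, hdη⟩ := (dense_addSubgroupClosure_pair_iff.2 hab).exists_between hη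
  obtain ⟨u, v, huv⟩ := AddSubgroup.mem_closure_pair.1 hd
  simp only [zsmul_eq_mul] at huv
  obtain ⟨hd0, hdη⟩ := hdη
  -- the base point `Q |u| a + Q |v| b` leaves room for adding up to `Q` copies of `d`
  set Q : ℕ := ⌈a / d⌉₊ with hQ
  have key : ∀ k : ℕ, k ≤ Q → ∀ w : ℤ, 0 ≤ (Q : ℤ) * |w| + k * w := fun k hk w => by
    have h1 : (k : ℤ) * |w| ≤ Q * |w| :=
      mul_le_mul_of_nonneg_right (by exact_mod_cast hk) (abs_nonneg w)
    have h2 : (k : ℤ) * (-w) ≤ k * |w| :=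
      mul_le_mul_of_nonneg_left (neg_le_abs w) (by positivity)
    linarith
  refine ⟨Q * |(u : ℝ)| * a + Q * |(v : ℝ)| * b, fun x hx => ?_⟩
  set C := Q * |(u : ℝ)| * a + Q * |(v : ℝ)| * b with hC
  set j : ℕ := ⌊(x - C) / a⌋₊ with hj
  have hj1 : j * a ≤ x - C := (le_div_iff₀ ha).1 (Nat.floor_le (div_nonneg (by linarith) ha.le))
  have hj2 : x - C < (j + 1) * a := (div_lt_iff₀ ha).1 (Nat.lt_floor_add_one _)
  set k : ℕ := ⌈(x - C - j * a) / d⌉₊ with hk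
  have hk1 : x - C - j * a ≤ k * d := (div_le_iff₀ hd0).1 (Nat.le_ceil _)
  have hk2 : k * d < x - C - j * a + d := by
    have := Nat.ceil_lt_add_one (a := (x - C - j * a) / d) (div_nonneg (by linarith) hd0.le)
    rw [← hk, div_add_one hd0.ne', lt_div_iff₀ hd0] at this
    exact this
  have hkQ : k ≤ Q := Nat.ceil_le_ceil (by gcongr; linarith)
  obtain ⟨m', hm'⟩ := Int.eq_ofNat_of_zero_le (key k hkQ u)
  obtain ⟨n', hn'⟩ := Int.eq_ofNat_of_zero_le (key k hkQ v)
  have hm : (m' : ℝ) = Q * |(u : ℝ)| + k * u := by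
    have := congrArg (fun t : ℤ => (t : ℝ)) hm'
    push_cast at this; linarith
  have hn : (n' : ℝ) = Q * |(v : ℝ)| + k * v := by
    have := congrArg (fun t : ℤ => (t : ℝ)) hn'
    push_cast at this; linarith
  have hsum : ((m' + j : ℕ) : ℝ) * a + n' * b = C + j * a + k * d := by
    push_cast; rw [hm, hn, hC, ← huv]; ring
  exact ⟨m' + j, n', by rw [hsum]; linarith, by rw [hsum]; linarith⟩

/-! ### Limits along filters -/

/-- A bounded function attains its upper limit `L` along some filter. -/
theorem exists_filter_tendsto_sup {h : ℝ → ℝ} {A B : ℝ} (hA : ∀ᶠ z in atTop, A ≤ h z)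
    (hB : ∀ᶠ z in atTop, h z ≤ B) :
    ∃ (L : ℝ) (F : Filter ℝ), F.NeBot ∧ F ≤ atTop ∧ Tendsto h F (𝓝 L) ∧
      ∀ δ > 0, ∀ᶠ z in atTop, h z ≤ L + δ := by
  have hb : IsBoundedUnder (· ≤ ·) atTop h := isBoundedUnder_of_eventually_le hB
  have hc : IsCoboundedUnder (· ≤ ·) atTop h :=
    (isBoundedUnder_of_eventually_ge hA).isCoboundedUnder_le
  have hub : ∀ δ > 0, ∀ᶠ z in atTop, h z ≤ limsup h atTop + δ := fun δ hδ =>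
    (eventually_lt_of_limsup_lt (lt_add_of_pos_right _ hδ) hb).mono fun _ => le_of_lt
  refine ⟨limsup h atTop, comap h (𝓝 (limsup h atTop)) ⊓ atTop, ?_, inf_le_right,
    tendsto_comap.mono_left inf_le_left, hub⟩
  rw [← frequently_true_iff_neBot, frequently_iff]
  intro U hU
  obtain ⟨V, hV, W, hW, rfl⟩ := mem_inf_iff.1 hU
  obtain ⟨T, hT, hTV⟩ := mem_comap.1 hV
  obtain ⟨ε, hε, hball⟩ := Metric.mem_nhds_iff.1 hT
  obtain ⟨z, hz1, hz2, hz3⟩ := ((frequently_lt_of_lt_limsup hc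
    (sub_lt_self (limsup h atTop) hε)).and_eventually ((hub (ε / 2) (half_pos hε)).and hW)).exists
  refine ⟨z, ⟨hTV (hball ?_), hz3⟩, trivial⟩
  rw [Metric.mem_ball, Real.dist_eq, abs_lt]
  constructor <;> linarith

/-- If all translates of `h` by elements of the semigroup of the `a i` tend to `L` along `F`, then
`h` is uniformly close to `L` on long intervals, because `h` decreases at most exponentially and
the semigroup is eventually dense. -/
theorem exists_eventually_forall_Icc {ι : Type*} {a : ι → ℝ} {h : ℝ → ℝ} (ha : ∀ i, 0 < a i)
    (hirr : ∃ i j, Irrational (a i / a j))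
    (h0 : ∀ z, 0 ≤ h z) (hmono : ∀ z t, 0 ≤ t → Real.exp (-t) * h z ≤ h (z + t))
    {L : ℝ} {F : Filter ℝ}
    (hF : ∀ s ∈ AddSubmonoid.closure (Set.range a), Tendsto (fun z => h (z - s)) F (𝓝 L))
    (M : ℝ) {ε : ℝ} (hε : 0 < ε) :
    ∃ S : ℝ, ∀ᶠ z in F, ∀ t ∈ Set.Icc S (S + M), |h (z - t) - L| ≤ ε := by
  obtain ⟨i, j, hij⟩ := hirr
  obtain ⟨η, hη, hη1, hη2⟩ : ∃ η > 0, Real.exp η * (L + η) < L + ε ∧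
      L - ε < Real.exp (-η) * (L - η) := by
    have hcont : Tendsto (fun x => Real.exp x * (L + x)) (𝓝 0) (𝓝 L) := by
      have : Continuous fun x => Real.exp x * (L + x) := by fun_prop
      simpa using this.tendsto 0
    have hneg : Tendsto (fun x : ℝ => -x) (𝓝 0) (𝓝 0) := by
      simpa using (continuous_neg (G := ℝ)).tendsto 0
    have e1 := hcont.eventually (gt_mem_nhds (show L < L + ε by linarith))
    have e2 := (hcont.comp hneg).eventually (lt_mem_nhds (show L - ε < L by linarith))
    have e3 : ∀ᶠ x : ℝ in 𝓝[>] 0, 0 < x := eventually_mem_nhdsWithin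
    obtain ⟨x, h1, h2, h3⟩ := (e3.and ((e1.and e2).filter_mono nhdsWithin_le_nhds)).exists
    exact ⟨x, h1, h2, by simpa [sub_eq_add_neg] using h3⟩
  obtain ⟨S, hS⟩ := exists_forall_ge_natCast_mul_add_mem_Ico (ha i) hij hη
  -- only finitely many elements of the semigroup are used
  set R := S + η + M + η with hR
  have hfin : ∀ᶠ z in F, ∀ q ∈ Finset.range ⌈R / a i⌉₊ ×ˢ Finset.range ⌈R / a j⌉₊,
      dist (h (z - (q.1 * a i + q.2 * a j))) L < η := by
    rw [Filter.eventually_all_finset]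
    rintro ⟨m, k⟩ -
    refine Metric.tendsto_nhds.1 (hF _ ?_) η hη
    rw [← nsmul_eq_mul, ← nsmul_eq_mul]
    exact add_mem (nsmul_mem (AddSubmonoid.subset_closure (Set.mem_range_self i)) m)
      (nsmul_mem (AddSubmonoid.subset_closure (Set.mem_range_self j)) k)
  refine ⟨S + η, hfin.mono fun z hz t ht => ?_⟩
  have hz' : ∀ m k : ℕ, m * a i + k * a j < R →
      |h (z - (m * a i + k * a j)) - L| < η := fun m k hmk => by
    have hm := mul_nonneg (Nat.cast_nonneg (α := ℝ) m) (ha i).le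
    have hk := mul_nonneg (Nat.cast_nonneg (α := ℝ) k) (ha j).le
    refine hz (m, k) (Finset.mem_product.2 ⟨Finset.mem_range.2 (Nat.lt_ceil.2 ?_),
      Finset.mem_range.2 (Nat.lt_ceil.2 ?_)⟩)
    · rw [lt_div_iff₀ (ha i)]; simp only; linarith
    · rw [lt_div_iff₀ (ha j)]; simp only; linarith
  obtain ⟨ht1, ht2⟩ := ht
  obtain ⟨m, k, hmk1, hmk2⟩ := hS t (by linarith)
  obtain ⟨m', k', hmk1', hmk2'⟩ := hS (t - η) (by linarith)
  have b1 := hz' m k (by linarith)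
  have b2 := hz' m' k' (by linarith)
  set s := m * a i + k * a j
  set s' := m' * a i + k' * a j
  rw [abs_lt] at b1 b2
  have lower : Real.exp (-η) * h (z - s) ≤ h (z - t) := by
    have := hmono (z - s) (s - t) (by linarith)
    rw [sub_add_sub_cancel] at this
    refine le_trans (mul_le_mul_of_nonneg_right (Real.exp_le_exp.2 ?_) (h0 _)) this
    linarith
  have upper : Real.exp (-η) * h (z - t) ≤ h (z - s') := by
    have := hmono (z - t) (t - s') (by linarith)
    rw [sub_add_sub_cancel] at this
    refine le_trans (mul_le_mul_of_nonneg_right (Real.exp_le_exp.2 ?_) (h0 _)) this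
    linarith
  have upper' : h (z - t) ≤ Real.exp η * h (z - s') := by
    have := mul_le_mul_of_nonneg_left upper (Real.exp_pos η).le
    rwa [← mul_assoc, ← Real.exp_add, add_neg_cancel, Real.exp_zero, one_mul] at this
  have c1 : Real.exp (-η) * (L - η) ≤ Real.exp (-η) * h (z - s) :=
    mul_le_mul_of_nonneg_left (by linarith) (Real.exp_pos _).le
  have c2 : Real.exp η * h (z - s') ≤ Real.exp η * (L + η) :=
    mul_le_mul_of_nonneg_left (by linarith) (Real.exp_pos _).le
  rw [abs_le]
  constructor <;> linarith

/-! ### The renewal theorem -/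

section Renewal

variable {ι : Type*} [Fintype ι] {p a : ι → ℝ} {h : ℝ → ℝ}

/-- If the average of the values `h (z - a i)` tends to the upper limit of `h` then each of them
does. -/
theorem tendsto_comp_sub_of_renewal (hp : ∀ i, 0 < p i) (hp1 : ∑ i, p i = 1)
    (hrec : ∀ z, 0 ≤ z → h z = ∑ i, p i * h (z - a i)) {L : ℝ}
    (hub : ∀ δ > 0, ∀ᶠ z in atTop, h z ≤ L + δ) {F : Filter ℝ} (hF : F ≤ atTop)
    (hL : Tendsto h F (𝓝 L)) (j : ι) : Tendsto (fun z => h (z - a j)) F (𝓝 L) := by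
  have hpj : p j ≤ 1 := hp1 ▸ Finset.single_le_sum (fun i _ => (hp i).le) (Finset.mem_univ j)
  rw [Metric.tendsto_nhds] at hL ⊢
  intro ε hε
  have hδ : 0 < p j * ε / 3 := by have := hp j; positivity
  have hsh : ∀ i, ∀ᶠ z in atTop, h (z - a i) ≤ L + p j * ε / 3 := fun i =>
    (tendsto_atTop_add_const_right atTop (-a i) tendsto_id).eventually (hub _ hδ)
  filter_upwards [hL _ hδ, hF (eventually_all.2 hsh), hF (eventually_ge_atTop 0)]
    with z hz1 hz2 hz0
  rw [Real.dist_eq, abs_lt] at hz1 ⊢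
  have hsum : h z - L - p j * ε / 3 = ∑ i, p i * (h (z - a i) - L - p j * ε / 3) := by
    simp only [mul_sub, Finset.sum_sub_distrib, ← Finset.sum_mul, hp1, one_mul, ← hrec z hz0]
  have hle : ∑ i, p i * (h (z - a i) - L - p j * ε / 3)
      ≤ p j * (h (z - a j) - L - p j * ε / 3) := by
    have := Finset.single_le_sum (f := fun i => -(p i * (h (z - a i) - L - p j * ε / 3)))
      (fun i _ => by
        have := mul_nonneg (hp i).le (sub_nonneg.2 (hz2 i))
        linarith) (Finset.mem_univ j)
    rw [Finset.sum_neg_distrib] at this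
    linarith
  have h3 : p j * ε / 3 ≤ ε / 3 := by nlinarith
  constructor
  · have h4 : p j * (-(2 / 3 * ε)) < p j * (h (z - a j) - L - p j * ε / 3) := by linarith
    have := lt_of_mul_lt_mul_left h4 (hp j).le
    linarith
  · have := hz2 j
    linarith

theorem tendsto_comp_sub_of_mem_closure (hp : ∀ i, 0 < p i) (hp1 : ∑ i, p i = 1)
    (hrec : ∀ z, 0 ≤ z → h z = ∑ i, p i * h (z - a i)) {L : ℝ}
    (hub : ∀ δ > 0, ∀ᶠ z in atTop, h z ≤ L + δ) {F : Filter ℝ} (hF : F ≤ atTop)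
    (hL : Tendsto h F (𝓝 L)) {s : ℝ} (hs : s ∈ AddSubmonoid.closure (Set.range a)) :
    Tendsto (fun z => h (z - s)) F (𝓝 L) := by
  induction hs using AddSubmonoid.closure_induction generalizing F with
  | mem x hx =>
    obtain ⟨j, rfl⟩ := hx
    exact tendsto_comp_sub_of_renewal hp hp1 hrec hub hF hL j
  | zero => simpa using hL
  | add x y _ _ ihx ihy =>
    have hG : map (fun z => z - x) F ≤ atTop :=
      (map_mono hF).trans (tendsto_atTop_add_const_right atTop (-x) tendsto_id)
    have := ihy hG (tendsto_map'_iff.2 (ihx hF hL))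
    simpa [Function.comp_def, sub_sub] using tendsto_map'_iff.1 this

/-- For a solution of the renewal equation, the quantity `∑ pᵢ ∫_{z - aᵢ}^z h` does not depend
on `z`. -/
theorem sum_mul_integral_eq (hrec : ∀ z, 0 ≤ z → h z = ∑ i, p i * h (z - a i))
    (hint : ∀ x y, IntervalIntegrable h MeasureTheory.volume x y) {z : ℝ} (hz : 0 ≤ z)
    (hp1 : ∑ i, p i = 1) :
    ∑ i, p i * ∫ t in (z - a i)..z, h t = ∑ i, p i * ∫ t in (-a i)..0, h t := by
  have hint' : ∀ i, IntervalIntegrable (fun t => h (t - a i)) MeasureTheory.volume 0 z :=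
    fun i => by simpa using (hint (0 - a i) (z - a i)).comp_sub_right (a i)
  have h1 : ∀ i, ∫ t in (z - a i)..z, h t
      = (∫ t in (-a i)..0, h t) + ((∫ t in (0 : ℝ)..z, h t) - ∫ t in (0 : ℝ)..z, h (t - a i)) := by
    intro i
    rw [intervalIntegral.integral_comp_sub_right, zero_sub,
      ← intervalIntegral.integral_add_adjacent_intervals (hint (z - a i) 0) (hint 0 z),
      ← intervalIntegral.integral_add_adjacent_intervals (hint (-a i) 0) (hint 0 (z - a i)),
      intervalIntegral.integral_symm (z - a i) 0]
    ring
  have h2 : ∫ t in (0 : ℝ)..z, h t = ∑ i, p i * ∫ t in (0 : ℝ)..z, h (t - a i) := by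
    simp only [← intervalIntegral.integral_const_mul]
    rw [← intervalIntegral.integral_finsetSum fun i _ => (hint' i).const_mul (p i)]
    refine intervalIntegral.integral_congr fun t ht => ?_
    rw [Set.uIcc_of_le hz] at ht
    exact hrec t ht.1
  simp only [h1, mul_add, mul_sub, Finset.sum_add_distrib, Finset.sum_sub_distrib,
    ← Finset.sum_mul, hp1, one_mul]
  rw [← h2]
  ring

/-- The conserved integral identifies every limit `L` that is attained along a filter together
with all translates by elements of the semigroup of the `a i`. -/
theorem mul_sum_eq_of_tendsto_comp_sub (hp : ∀ i, 0 < p i) (hp1 : ∑ i, p i = 1)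
    (ha : ∀ i, 0 < a i) (hirr : ∃ i j, Irrational (a i / a j))
    (hrec : ∀ z, 0 ≤ z → h z = ∑ i, p i * h (z - a i))
    (hint : ∀ x y, IntervalIntegrable h MeasureTheory.volume x y)
    (h0 : ∀ z, 0 ≤ h z) (hmono : ∀ z t, 0 ≤ t → Real.exp (-t) * h z ≤ h (z + t))
    {L : ℝ} {F : Filter ℝ} [F.NeBot] (hFtop : F ≤ atTop)
    (hF : ∀ s ∈ AddSubmonoid.closure (Set.range a), Tendsto (fun z => h (z - s)) F (𝓝 L)) :
    L * ∑ i, p i * a i = ∑ i, p i * ∫ t in (-a i)..0, h t := by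
  set μ := ∑ i, p i * a i with hμ
  have hμ0 : 0 ≤ μ := Finset.sum_nonneg fun i _ => (mul_pos (hp i) (ha i)).le
  have hbound : ∀ ε > 0, |L * μ - ∑ i, p i * ∫ t in (-a i)..0, h t| ≤ ε * μ := by
    intro ε hε
    obtain ⟨S, hS⟩ := exists_eventually_forall_Icc ha hirr h0 hmono hF (∑ i, a i) hε
    obtain ⟨z, hz, hzS⟩ := (hS.and (hFtop (eventually_ge_atTop S))).exists
    rw [← sum_mul_integral_eq hrec hint (sub_nonneg.2 hzS) hp1, abs_sub_comm, hμ, Finset.mul_sum,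
      ← Finset.sum_sub_distrib, Finset.mul_sum]
    refine (Finset.abs_sum_le_sum_abs _ _).trans (Finset.sum_le_sum fun i _ => ?_)
    have hai : a i ≤ ∑ i, a i := Finset.single_le_sum (fun i _ => (ha i).le) (Finset.mem_univ i)
    have hI : ‖∫ t in (z - S - a i)..(z - S), (h t - L)‖ ≤ ε * |z - S - (z - S - a i)| := by
      refine intervalIntegral.norm_integral_le_of_norm_le_const fun t ht => ?_
      rw [Set.uIoc_of_le (by have := ha i; linarith)] at ht
      have := hz (z - t) ⟨by linarith [ht.2], by linarith [ht.1]⟩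
      rwa [sub_sub_cancel] at this
    rw [intervalIntegral.integral_sub (hint _ _) intervalIntegrable_const,
      intervalIntegral.integral_const, sub_sub_cancel, abs_of_pos (ha i), smul_eq_mul,
      Real.norm_eq_abs] at hI
    calc |p i * (∫ t in (z - S - a i)..(z - S), h t) - L * (p i * a i)|
        = p i * |(∫ t in (z - S - a i)..(z - S), h t) - a i * L| := by
          rw [← abs_of_pos (hp i), ← abs_mul, abs_of_pos (hp i)]; ring_nf
      _ ≤ p i * (ε * a i) := mul_le_mul_of_nonneg_left hI (hp i).le
      _ = ε * (p i * a i) := by ring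
  rw [← sub_eq_zero, ← abs_nonpos_iff]
  refine le_of_forall_pos_le_add fun ε hε => ?_
  have h1 := hbound (ε / (μ + 1)) (by positivity)
  have h2 : ε / (μ + 1) * μ ≤ ε := by
    rw [div_mul_eq_mul_div, div_le_iff₀ (by positivity)]
    nlinarith
  linarith

/-- The **renewal theorem** for finitely many steps `a i` with probabilities `p i`, for bounded
solutions of the homogeneous renewal equation that decrease at most exponentially. -/
theorem tendsto_of_renewal (hp : ∀ i, 0 < p i) (hp1 : ∑ i, p i = 1)
    (ha : ∀ i, 0 < a i) (hirr : ∃ i j, Irrational (a i / a j))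
    (hrec : ∀ z, 0 ≤ z → h z = ∑ i, p i * h (z - a i))
    (hint : ∀ x y, IntervalIntegrable h MeasureTheory.volume x y)
    (h0 : ∀ z, 0 ≤ h z) (hmono : ∀ z t, 0 ≤ t → Real.exp (-t) * h z ≤ h (z + t))
    {B : ℝ} (hB : ∀ᶠ z in atTop, h z ≤ B) :
    Tendsto h atTop (𝓝 ((∑ i, p i * ∫ t in (-a i)..0, h t) / ∑ i, p i * a i)) := by
  have hμ : 0 < ∑ i, p i * a i :=
    Finset.sum_pos (fun i _ => mul_pos (hp i) (ha i)) ⟨hirr.choose, Finset.mem_univ _⟩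
  obtain ⟨L, F, hFne, hF, hL, hub⟩ := exists_filter_tendsto_sup (.of_forall h0) hB
  -- the lower limit of `h` is minus the upper limit of `-h`
  obtain ⟨K, G, hGne, hG, hK, hlb⟩ := exists_filter_tendsto_sup (h := fun z => -h z) (A := -B)
    (B := 0) (hB.mono fun z hz => neg_le_neg hz) (.of_forall fun z => neg_nonpos.2 (h0 z))
  have hrec' : ∀ z, 0 ≤ z → -h z = ∑ i, p i * -h (z - a i) := fun z hz => by
    simp only [mul_neg, Finset.sum_neg_distrib, hrec z hz]
  have e1 := mul_sum_eq_of_tendsto_comp_sub hp hp1 ha hirr hrec hint h0 hmono hF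
    fun s hs => tendsto_comp_sub_of_mem_closure hp hp1 hrec hub hF hL hs
  have e2 := mul_sum_eq_of_tendsto_comp_sub (L := -K) hp hp1 ha hirr hrec hint h0 hmono hG
    fun s hs => by
      simpa using (tendsto_comp_sub_of_mem_closure hp hp1 hrec' hlb hG hK hs).neg
  rw [← e1, mul_div_cancel_right₀ _ hμ.ne']
  have hKL : L = -K := mul_right_cancel₀ hμ.ne' (e1.trans e2.symm)
  rw [Metric.tendsto_nhds]
  intro ε hε
  filter_upwards [hub (ε / 2) (half_pos hε), hlb (ε / 2) (half_pos hε)] with z hz1 hz2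
  rw [Real.dist_eq, abs_lt]
  constructor <;> linarith

end Renewal

/-! ### Counting words -/

section Words

variable {ι : Type*} [Fintype ι]

/-- A finite set of words splits into the empty word and the words with a given first letter. -/
theorem ncard_words {S : Set (List ι)} (hS : S.Finite) [Decidable ([] ∈ S)] :
    S.ncard = (if [] ∈ S then 1 else 0) + ∑ i, {l | i :: l ∈ S}.ncard := by
  classical
  have hfib : ∀ i, {l | i :: l ∈ S}.ncard = {l ∈ hS.toFinset | l.head? = some i}.card := fun i => by
    rw [← Set.ncard_coe_finset, ← Set.ncard_image_of_injective _ (List.cons_injective (a := i))]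
    congr 1
    ext l
    cases l with
    | nil => simp
    | cons j l => simp; aesop
  have hnil : {l ∈ hS.toFinset | l.head? = none}.card = if [] ∈ S then 1 else 0 := by
    split_ifs with hn
    · rw [Finset.card_eq_one]
      refine ⟨[], ?_⟩
      ext l
      cases l <;> simp [hn]
    · rw [Finset.card_eq_zero]
      ext l
      cases l <;> simp [hn]
  rw [Set.ncard_eq_toFinset_card S hS, Finset.card_eq_sum_card_fiberwise (f := List.head?)
    (t := Finset.univ) (fun _ _ => Finset.mem_coe.2 (Finset.mem_univ _)), Fintype.sum_option, hnil]
  simp only [hfib]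

theorem finite_words_sum_le {a : ι → ℝ} (ha : ∀ i, 0 < a i) (z : ℝ) :
    {l : List ι | (l.map a).sum ≤ z}.Finite := by
  obtain ⟨m, hm, hma⟩ : ∃ m > 0, ∀ i, m ≤ a i := by
    rcases isEmpty_or_nonempty ι with h | h
    · exact ⟨1, one_pos, h.elim⟩
    · obtain ⟨i, hi⟩ := Finite.exists_min a
      exact ⟨a i, ha i, hi⟩
  refine (List.finite_length_le ι ⌊z / m⌋₊).subset fun l hl => ?_
  refine Nat.le_floor ((le_div_iff₀ hm).2 (le_trans ?_ hl))
  have := List.card_nsmul_le_sum (l.map a) m (by simpa using fun i _ => hma i)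
  simpa using this

/-- The number of words of cost at most `z`, where the letter `i` costs `a i`. -/
noncomputable def wordCount (a : ι → ℝ) (z : ℝ) : ℕ :=
  {l : List ι | (l.map a).sum ≤ z}.ncard

theorem monotone_wordCount {a : ι → ℝ} (ha : ∀ i, 0 < a i) : Monotone (wordCount a) :=
  fun _ y hxy => Set.ncard_le_ncard (fun _ hl => le_trans hl hxy) (finite_words_sum_le ha y)

theorem wordCount_of_neg {a : ι → ℝ} (ha : ∀ i, 0 < a i) {z : ℝ} (hz : z < 0) :
    wordCount a z = 0 := by
  rw [wordCount, Set.ncard_eq_zero (finite_words_sum_le ha z), Set.eq_empty_iff_forall_notMem]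
  intro l hl
  have : 0 ≤ (l.map a).sum := List.sum_nonneg (by simpa using fun i _ => (ha i).le)
  exact absurd hl (not_le.2 (hz.trans_le this))

theorem wordCount_of_nonneg {a : ι → ℝ} (ha : ∀ i, 0 < a i) {z : ℝ} (hz : 0 ≤ z) :
    wordCount a z = 1 + ∑ i, wordCount a (z - a i) := by
  classical
  rw [wordCount, ncard_words (finite_words_sum_le ha z)]
  simp [wordCount, hz, le_sub_iff_add_le']

/-- The number of words of cost at most `z` is asymptotic to `e ^ z / ∑ aᵢ e ^ (-aᵢ)`. With
`c = 1 / (n - 1)`, where `n` is the number of letters, `wordCount a z + c` satisfies the renewal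
equation without an inhomogeneous term. -/
theorem tendsto_wordCount {a : ι → ℝ} (ha : ∀ i, 0 < a i) (hirr : ∃ i j, Irrational (a i / a j))
    (h1 : ∑ i, Real.exp (-a i) = 1) :
    Tendsto (fun z => wordCount a z / Real.exp z) atTop
      (𝓝 (∑ i, a i * Real.exp (-a i))⁻¹) := by
  have hcard : 1 < (Fintype.card ι : ℝ) := by
    obtain ⟨i, j, hij⟩ := hirr
    have hne : i ≠ j := by
      rintro rfl
      rw [div_self (ha i).ne'] at hij
      exact hij.ne_one rfl
    exact_mod_cast Fintype.one_lt_card_iff.2 ⟨i, j, hne⟩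
  obtain ⟨c, hc0, hc⟩ : ∃ c : ℝ, 0 < c ∧ 1 + c = Fintype.card ι * c :=
    ⟨1 / (Fintype.card ι - 1), by have := sub_pos.2 hcard; positivity, by
      have := (sub_pos.2 hcard).ne'
      field_simp
      ring⟩
  set h : ℝ → ℝ := fun z => Real.exp (-z) * (wordCount a z + c) with hh
  have h0 : ∀ z, 0 ≤ h z := fun z => by positivity
  have hrec : ∀ z, 0 ≤ z → h z = ∑ i, Real.exp (-a i) * h (z - a i) := fun z hz => by
    have : ∀ i, Real.exp (-a i) * h (z - a i)
        = Real.exp (-z) * (wordCount a (z - a i) + c) := fun i => by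
      rw [hh, ← mul_assoc, ← Real.exp_add]
      ring_nf
    simp only [this, ← Finset.mul_sum, Finset.sum_add_distrib, Finset.sum_const, Finset.card_univ,
      nsmul_eq_mul, ← hc]
    rw [hh]
    simp only [wordCount_of_nonneg ha hz]
    push_cast
    ring
  have hmono : ∀ z t, 0 ≤ t → Real.exp (-t) * h z ≤ h (z + t) := fun z t ht => by
    have : (wordCount a z : ℝ) ≤ wordCount a (z + t) :=
      Nat.cast_le.2 (monotone_wordCount ha (by linarith))
    simp only [hh]
    rw [← mul_assoc, ← Real.exp_add, show -t + -z = -(z + t) by ring]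
    gcongr
  have hint : ∀ x y, IntervalIntegrable h MeasureTheory.volume x y := fun x y => by
    have hm : Monotone fun z => (wordCount a z + c : ℝ) := fun u v huv =>
      by simpa using monotone_wordCount ha huv
    exact hm.intervalIntegrable.continuousOn_mul (by fun_prop)
  have hneg : ∀ z < 0, h z = c * Real.exp (-z) := fun z hz => by
    simp [hh, wordCount_of_neg ha hz, mul_comm]
  -- maximum principle: `h` never exceeds its bound on `[-∑ aᵢ, 0)`
  have hB : ∀ᶠ z in atTop, h z ≤ c * Real.exp (∑ i, a i) := by
    obtain ⟨i₀, hi₀⟩ := have : Nonempty ι := ⟨hirr.choose⟩; Finite.exists_min a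
    have hstep : ∀ k : ℕ, ∀ z, -∑ i, a i ≤ z → z < k * a i₀ →
        h z ≤ c * Real.exp (∑ i, a i) := by
      intro k
      induction k with
      | zero =>
        intro z hz1 hz2
        rw [hneg z (by simpa using hz2)]
        gcongr
        linarith
      | succ k ih =>
        intro z hz1 hz2
        rcases lt_or_ge z 0 with hz | hz
        · rw [hneg z hz]
          gcongr
          linarith
        · rw [hrec z hz, ← one_mul (c * _), ← h1, Finset.sum_mul]
          refine Finset.sum_le_sum fun i _ =>
            mul_le_mul_of_nonneg_left (ih _ ?_ ?_) (Real.exp_pos _).le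
          · have := Finset.single_le_sum (fun i _ => (ha i).le) (Finset.mem_univ i)
            linarith
          · push_cast at hz2
            have := hi₀ i
            linarith
    filter_upwards [eventually_ge_atTop 0] with z hz
    obtain ⟨k, hk⟩ := exists_nat_gt (z / a i₀)
    exact hstep k z (le_trans (neg_nonpos.2 (Finset.sum_nonneg fun i _ => (ha i).le)) hz)
      ((div_lt_iff₀ (ha i₀)).1 hk)
  have hlim := tendsto_of_renewal (fun i => Real.exp_pos (-a i)) h1 ha hirr hrec hint h0 hmono hB
  have hI : ∀ i, ∫ t in (-a i)..0, h t = c * (Real.exp (a i) - 1) := fun i => by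
    have : ∫ t in (-a i)..0, h t = ∫ t in (-a i)..0, c * Real.exp (-t) := by
      refine intervalIntegral.integral_congr_ae ?_
      filter_upwards [MeasureTheory.compl_mem_ae_iff.2 (MeasureTheory.measure_singleton (0 : ℝ))]
        with t ht0 ht
      rw [Set.uIoc_of_le (by have := ha i; linarith)] at ht
      exact hneg t (lt_of_le_of_ne ht.2 ht0)
    rw [this, intervalIntegral.integral_const_mul, intervalIntegral.integral_comp_neg
      (fun t => Real.exp t)]
    simp
  have hA : ∑ i, Real.exp (-a i) * ∫ t in (-a i)..0, h t = 1 := by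
    have : ∀ i, Real.exp (-a i) * ∫ t in (-a i)..0, h t = c - c * Real.exp (-a i) := fun i => by
      have he : Real.exp (-a i) * Real.exp (a i) = 1 := by simp [← Real.exp_add]
      rw [hI]
      linear_combination c * he
    simp only [this, Finset.sum_sub_distrib, ← Finset.mul_sum, h1, Finset.sum_const,
      Finset.card_univ, nsmul_eq_mul]
    linarith
  rw [hA, one_div] at hlim
  have hsub := hlim.sub ((Real.tendsto_exp_neg_atTop_nhds_zero).const_mul c)
  simp only [mul_zero, sub_zero] at hsub
  simp only [mul_comm (a _)]
  refine hsub.congr fun z => ?_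
  rw [hh, div_eq_mul_inv, ← Real.exp_neg]
  ring

end Words

/-! ### Multinomial coefficients count words -/

section Multinomial

variable {ι : Type*} [Fintype ι] [DecidableEq ι]

theorem length_eq_sum_count (l : List ι) : l.length = ∑ i, l.count i := by
  have := Multiset.sum_count_eq_card (s := Finset.univ) (m := (l : Multiset ι))
    fun _ _ => Finset.mem_univ _
  simpa using this.symm

theorem finite_words_count_eq (k : ι → ℕ) : {l : List ι | (fun i => l.count i) = k}.Finite := by
  refine (List.finite_length_le ι (∑ i, k i)).subset fun l hl => ?_
  rw [Set.mem_ofPred_eq] at hl ⊢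
  rw [length_eq_sum_count, ← hl]

/-- The words in which each letter `i` occurs `k i` times are counted by the multinomial
coefficient; by induction over the length, by removing the first letter. -/
theorem ncard_words_count_eq (k : ι → ℕ) :
    {l : List ι | (fun i => l.count i) = k}.ncard = Nat.multinomial Finset.univ k := by
  suffices H : ∀ m, ∀ k : ι → ℕ, ∑ i, k i = m →
      (∏ i, (k i).factorial) * {l : List ι | (fun i => l.count i) = k}.ncard = m.factorial by
    have h1 := H _ k rfl
    rw [← Nat.multinomial_spec] at h1
    exact Nat.eq_of_mul_eq_mul_left
      (Finset.prod_pos fun i _ => Nat.factorial_pos _) h1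
  intro m
  induction m with
  | zero =>
    intro k hk
    have hk0 : k = 0 := funext fun i => by simpa using Finset.sum_eq_zero_iff.1 hk i
    have : {l : List ι | (fun i => l.count i) = k} = {[]} := by
      ext l
      rw [Set.mem_ofPred_eq, Set.mem_singleton_iff, hk0, ← List.length_eq_zero_iff,
        length_eq_sum_count]
      simp [funext_iff]
    rw [this, hk0]
    simp
  | succ m ih =>
    intro k hk
    have hnil : [] ∉ {l : List ι | (fun i => l.count i) = k} := fun h => by
      have : k = 0 := by rw [← h.out]; ext; simp
      simp [this] at hk
    rw [ncard_words (finite_words_count_eq k), if_neg hnil, zero_add, Finset.mul_sum,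
      Nat.factorial_succ, ← hk, Finset.sum_mul]
    refine Finset.sum_congr rfl fun i _ => ?_
    rcases Nat.eq_zero_or_pos (k i) with hi | hi
    · have : {l | i :: l ∈ {l : List ι | (fun j => l.count j) = k}} = ∅ := by
        ext l
        simp only [Set.mem_ofPred_eq, Set.mem_empty_iff_false, iff_false]
        intro h
        have := congrFun h i
        simp [hi] at this
      rw [this, hi]
      simp
    · obtain ⟨q, hq⟩ := Nat.exists_eq_add_one_of_ne_zero hi.ne'
      have hset : {l | i :: l ∈ {l : List ι | (fun j => l.count j) = k}}
          = {l : List ι | (fun j => l.count j) = Function.update k i q} := by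
        ext l
        simp only [Set.mem_ofPred_eq, funext_iff]
        refine forall_congr' fun j => ?_
        rcases eq_or_ne j i with rfl | hj
        · simp [hq]
        · simp [hj, hj.symm]
      have hks : k = Function.update (Function.update k i q) i (q + 1) := by
        simp [← hq]
      have hsum : ∑ j, Function.update k i q j = m := by
        rw [Finset.sum_update_of_mem (Finset.mem_univ i)]
        rw [hks, Finset.sum_update_of_mem (Finset.mem_univ i)] at hk
        have : ∑ x ∈ Finset.univ \ {i}, Function.update k i q x = ∑ x ∈ Finset.univ \ {i}, k x :=
          Finset.sum_congr rfl fun x hx => by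
            rw [Function.update_of_ne (by simpa using hx)]
        omega
      have hprod : ∏ j, (k j).factorial
          = (q + 1) * ∏ j, (Function.update k i q j).factorial := by
        rw [← Finset.mul_prod_erase _ _ (Finset.mem_univ i),
          ← Finset.mul_prod_erase _ (fun j => (Function.update k i q j).factorial)
            (Finset.mem_univ i), hq, Nat.factorial_succ, Function.update_self, mul_assoc]
        congr 2
        exact Finset.prod_congr rfl fun j hj => by
          rw [Function.update_of_ne (Finset.ne_of_mem_erase hj)]
      rw [hset, hprod, mul_assoc, ih _ hsum, hq]

end Multinomial

theorem sum_map_eq_sum_mul_count {n : ℕ} (a : Fin n → ℝ) (l : List (Fin n)) :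
    (l.map a).sum = ∑ i, a i * l.count i := by
  rw [Finset.sum_list_map_count, Finset.sum_subset (Finset.subset_univ _)]
  · simp [mul_comm]
  · intro i _ hi
    simp [List.count_eq_zero.2 fun h => hi (List.mem_toFinset.2 h)]

theorem multinomialSum_eq_wordCount {n : ℕ} {a : Fin n → ℝ} (ha : ∀ i, 0 < a i) (z : ℝ) :
    multinomialSum a z = wordCount a z := by
  have hmem : ∀ l : List (Fin n), (fun i => l.count i) ∈ latticePoints a z ↔
      (l.map a).sum ≤ z := fun l => by
    rw [sum_map_eq_sum_mul_count]
    simp [latticePoints, simplex]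
  rw [multinomialSum, finsum_mem_eq_finite_toFinset_sum _ (finite_latticePoints ha z), wordCount,
    Set.ncard_eq_toFinset_card _ (finite_words_sum_le ha z),
    Finset.card_eq_sum_card_fiberwise (f := fun (l : List (Fin n)) i => l.count i)
      (t := (finite_latticePoints ha z).toFinset)]
  · rw [Nat.cast_sum]
    refine Finset.sum_congr rfl fun k hk => ?_
    rw [← ncard_words_count_eq, ← Set.ncard_coe_finset]
    congr 2
    ext l
    simp only [Finset.coe_filter, Set.Finite.mem_toFinset, Set.mem_ofPred_eq]
    refine ⟨fun h => ⟨(hmem l).1 (h ▸ (Set.Finite.mem_toFinset _).1 hk), h⟩, fun h => h.2⟩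
  · intro l hl
    simp only [Set.Finite.coe_toFinset] at hl ⊢
    exact (hmem l).2 hl

/-! ### Rankings -/

/-- A countably infinite set in which only finitely many elements are at least as probable as any
given one can be ranked. -/
theorem exists_isRanking {W : Type} [Encodable W] [Infinite W] {prob : W → ℝ}
    (hfin : ∀ v, {u | prob v ≤ prob u}.Finite) :
    ∃ w, IsRanking prob w := by
  -- ties are broken by an arbitrary enumeration
  let key : W → ℝ ×ₗ ℕ := fun v => toLex (-prob v, Encodable.encode v)
  have hkey : Function.Injective key := fun u v h =>
    Encodable.encode_injective (congrArg (fun q => (ofLex q).2) h)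
  have hkfin : ∀ v, {u | key u < key v}.Finite := fun v =>
    (hfin v).subset fun u hu => by
      rcases Prod.Lex.toLex_lt_toLex.1 hu with h | h
      · exact (neg_lt_neg_iff.1 h).le
      · exact (neg_inj.1 h.1).ge
  let f : W → ℕ := fun v => {u | key u < key v}.ncard
  have hf : ∀ u v, key u < key v → f u < f v := fun u v huv =>
    Set.ncard_lt_ncard ⟨fun x hx => lt_trans hx huv, fun h => lt_irrefl (key u) (h huv)⟩ (hkfin v)
  have hfinj : Function.Injective f := fun u v h => by
    rcases lt_trichotomy (key u) (key v) with h' | h' | h'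
    · exact absurd h (hf _ _ h').ne
    · exact hkey h'
    · exact absurd h (hf _ _ h').ne'
  have : Infinite (Set.range f) := (Set.infinite_range_of_injective hfinj).to_subtype
  classical
  let e : ℕ ≃o Set.range f := Nat.Subtype.orderIsoOfNat (Set.range f)
  let g : ℕ ≃ W := e.toEquiv.trans (Equiv.ofInjective f hfinj).symm
  have hfg : ∀ k, f (g k) = e k := fun k => Equiv.apply_ofInjective_symm hfinj _
  refine ⟨fun r => g (r - 1), ⟨fun _ _ => trivial, ?_, ?_⟩, ?_⟩
  · intro r hr s hs hrs
    have := g.injective hrs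
    simp only [Set.mem_Ici] at hr hs
    omega
  · intro v _
    exact ⟨g.symm v + 1, by simp, by simp⟩
  · intro r hr s hs hrs
    by_contra hlt
    have hlt' : key (g (s - 1)) < key (g (r - 1)) :=
      Prod.Lex.toLex_lt_toLex.2 (.inl (neg_lt_neg (not_le.1 hlt)))
    have h2 := hf _ _ hlt'
    rw [hfg, hfg] at h2
    have h3 := e.lt_iff_lt.1 (Subtype.coe_lt_coe.1 h2)
    omega

/-- If the number of elements of cost at most `z` is asymptotic to `κ e ^ z`, then the cost `c` of
the element of rank `r` satisfies `r ∼ κ e ^ c`: this element lies between the elements of cost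
at most `c - ε` and those of cost at most `c`. -/
theorem tendsto_natCast_div_exp_rank {W : Type} {prob cost : W → ℝ} {w : ℕ → W}
    (hw : IsRanking prob w) (hcost : ∀ u v, prob u ≤ prob v ↔ cost v ≤ cost u)
    (hfin : ∀ z, {v | cost v ≤ z}.Finite) {κ : ℝ}
    (hκ : Tendsto (fun z => {v | cost v ≤ z}.ncard / Real.exp z) atTop (𝓝 κ)) :
    Tendsto (fun r : ℕ => r / Real.exp (cost (w r))) atTop (𝓝 κ) := by
  obtain ⟨⟨-, hinj, hsurj⟩, hanti⟩ := hw
  have hmono : ∀ r s, 1 ≤ r → r ≤ s → cost (w r) ≤ cost (w s) := fun r s hr hrs =>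
    (hcost _ _).1 (hanti hr (le_trans hr hrs) hrs)
  have hcard : ∀ r, (w '' Set.Icc 1 r).ncard = r := fun r => by
    rw [Set.InjOn.ncard_image (hinj.mono fun s hs => hs.1), Set.ncard_eq_toFinset_card',
      Set.toFinset_Icc, Nat.card_Icc, Nat.add_sub_cancel]
  have hle : ∀ r, r ≤ {v | cost v ≤ cost (w r)}.ncard := fun r => by
    have h1 : (w '' Set.Icc 1 r) ⊆ {v | cost v ≤ cost (w r)} := by
      rintro _ ⟨s, hs, rfl⟩
      exact hmono s r hs.1 hs.2
    have h2 := Set.ncard_le_ncard h1 (hfin _)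
    rwa [hcard] at h2
  have hge : ∀ r z, 1 ≤ r → z < cost (w r) → {v | cost v ≤ z}.ncard ≤ r := fun r z hr hz => by
    have h1 : {v | cost v ≤ z} ⊆ w '' Set.Icc 1 r := by
      intro v hv
      obtain ⟨s, hs, rfl⟩ := hsurj (Set.mem_univ v)
      refine ⟨s, ⟨hs, ?_⟩, rfl⟩
      by_contra hrs
      exact absurd (hmono r s hr (not_le.1 hrs).le) (not_le.2 (lt_of_le_of_lt hv hz))
    have h2 := Set.ncard_le_ncard h1 ((Set.finite_Icc 1 r).image w)
    rwa [hcard] at h2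
  have htop : Tendsto (fun r => cost (w r)) atTop atTop := by
    refine tendsto_atTop.2 fun z => ?_
    filter_upwards [eventually_gt_atTop ({v | cost v ≤ z}.ncard)] with r hr
    by_contra hlt
    exact absurd ((hle r).trans (Set.ncard_le_ncard
      (fun v hv => le_trans hv (not_le.1 hlt).le) (hfin z))) (not_le.2 hr)
  rw [tendsto_order]
  constructor
  · intro x hx
    obtain ⟨ε, hε, hxε⟩ : ∃ ε > 0, x < κ * Real.exp (-ε) := by
      have : Tendsto (fun ε => κ * Real.exp (-ε)) (𝓝 0) (𝓝 κ) := by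
        have : Continuous fun ε => κ * Real.exp (-ε) := by fun_prop
        simpa using this.tendsto 0
      have e1 : ∀ᶠ ε : ℝ in 𝓝[>] 0, 0 < ε := eventually_mem_nhdsWithin
      exact (e1.and ((this.eventually (lt_mem_nhds hx)).filter_mono nhdsWithin_le_nhds)).exists
    have h1 := ((hκ.comp (tendsto_atTop_add_const_right _ (-ε) htop)).mul_const
      (Real.exp (-ε))).eventually (lt_mem_nhds hxε)
    filter_upwards [h1, eventually_ge_atTop 1] with r hr hr1
    refine hr.trans_le ?_
    have h2 : (({v | cost v ≤ cost (w r) + -ε}.ncard : ℕ) : ℝ) ≤ r :=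
      Nat.cast_le.2 (hge r _ hr1 (by linarith))
    simp only [Function.comp_apply]
    rw [div_mul_eq_mul_div, Real.exp_add, mul_div_mul_right _ _ (Real.exp_ne_zero _)]
    gcongr
  · intro x hx
    filter_upwards [(hκ.comp htop).eventually (gt_mem_nhds hx)] with r hr
    refine lt_of_le_of_lt ?_ hr
    have h2 : (r : ℝ) ≤ ({v | cost v ≤ cost (w r)}.ncard : ℕ) := Nat.cast_le.2 (hle r)
    simp only [Function.comp_apply]
    gcongr

/-! ### Ranked words -/

theorem ne_of_irrational_div {ι : Type*} {x : ι → ℝ} {i j : ι} (h : Irrational (x i / x j)) :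
    i ≠ j := by
  rintro rfl
  rcases eq_or_ne (x i) 0 with h0 | h0
  · rw [h0, div_zero] at h
    exact h.ne_zero rfl
  · rw [div_self h0] at h
    exact h.ne_one rfl

theorem lt_one_of_sum_eq_one {ι : Type*} [Fintype ι] [Nontrivial ι] {p : ι → ℝ}
    (hp : ∀ i, 0 < p i) (hp1 : ∑ i, p i = 1) (i : ι) : p i < 1 := by
  obtain ⟨j, hj⟩ := exists_ne i
  exact hp1 ▸ Finset.single_lt_sum hj (Finset.mem_univ i) (Finset.mem_univ j) (hp j)
    fun k _ _ => (hp k).le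

theorem prod_map_eq_exp_sum_log {ι : Type*} {q : ι → ℝ} (hq : ∀ i, 0 < q i) (l : List ι) :
    (l.map q).prod = Real.exp (l.map fun i => Real.log (q i)).sum := by
  induction l with
  | nil => simp
  | cons i l ih => simp [ih, Real.exp_add, Real.exp_log (hq i)]

theorem entropy_rpow {n : ℕ} {q : Fin n → ℝ} (hq : ∀ i, 0 < q i) (γ : ℝ) :
    entropy (fun i => q i ^ γ) = -γ * ∑ i, q i ^ γ * Real.log (q i) := by
  simp only [entropy, Real.log_rpow (hq _), Finset.mul_sum, ← Finset.sum_neg_distrib]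
  exact Finset.sum_congr rfl fun i _ => by ring

theorem entropy_pos {n : ℕ} [Nonempty (Fin n)] {q : Fin n → ℝ} (hq : ∀ i, 0 < q i)
    (hq1 : ∀ i, q i < 1) : 0 < entropy q := by
  rw [entropy, ← Finset.sum_neg_distrib]
  exact Finset.sum_pos (fun i _ => by
    have := mul_pos (hq i) (neg_pos.2 (Real.log_neg (hq i) (hq1 i)))
    linarith) Finset.univ_nonempty

/-- The words with probabilities `C ∏ q i` can be ranked, and when `γ` is the exponent with
`∑ q i ^ γ = 1`, the rank of a word is asymptotically inversely proportional to the `γ`-th power of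
its probability. The costs `-γ log (q i)` of the letters reduce this to counting words by cost. -/
theorem ranking_of_prob_eq {n : ℕ} {q : Fin n → ℝ} (hq : ∀ i, 0 < q i) (hq1 : ∀ i, q i < 1)
    (hirr : ∃ i j, Irrational (Real.log (q i) / Real.log (q j))) {γ : ℝ} (hγ : 0 < γ)
    (hsum : ∑ i, q i ^ γ = 1) {C : ℝ} (hC : 0 < C) {prob : List (Fin n) → ℝ}
    (hprob : ∀ u, prob u = C * (u.map q).prod) :
    (∃ w, IsRanking prob w) ∧ ∀ w, IsRanking prob w →
      Tendsto (fun r : ℕ => r * (prob (w r) / C) ^ γ) atTop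
        (𝓝 (entropy fun i => q i ^ γ)⁻¹) := by
  set a : Fin n → ℝ := fun i => -γ * Real.log (q i) with ha_def
  have ha : ∀ i, 0 < a i := fun i =>
    mul_pos_of_neg_of_neg (neg_neg_of_pos hγ) (Real.log_neg (hq i) (hq1 i))
  have hexp : ∀ i, Real.exp (-a i) = q i ^ γ := fun i => by
    rw [Real.rpow_def_of_pos (hq i), ha_def]
    ring_nf
  have hcost : ∀ u : List (Fin n), (u.map a).sum = -γ * (u.map fun i => Real.log (q i)).sum :=
    fun u => List.sum_map_mul_left ..
  have hle : ∀ u v, prob u ≤ prob v ↔ (v.map a).sum ≤ (u.map a).sum := fun u v => by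
    rw [hprob, hprob, mul_le_mul_iff_right₀ hC, prod_map_eq_exp_sum_log hq,
      prod_map_eq_exp_sum_log hq, Real.exp_le_exp, hcost, hcost,
      mul_le_mul_left_of_neg (neg_neg_of_pos hγ)]
  have hfin := finite_words_sum_le ha
  constructor
  · have : Nonempty (Fin n) := ⟨hirr.choose⟩
    refine exists_isRanking fun v => ?_
    simpa only [hle] using hfin (v.map a).sum
  · intro w hw
    have hirr' : ∃ i j, Irrational (a i / a j) := by
      obtain ⟨i, j, hij⟩ := hirr
      exact ⟨i, j, by rwa [mul_div_mul_left _ _ (neg_neg_of_pos hγ).ne]⟩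
    have hH : ∑ i, a i * Real.exp (-a i) = entropy fun i => q i ^ γ := by
      rw [entropy_rpow hq, Finset.mul_sum]
      exact Finset.sum_congr rfl fun i _ => by rw [hexp, ha_def]; ring
    have hcount := tendsto_wordCount ha hirr' (by simpa only [hexp] using hsum)
    rw [hH] at hcount
    refine (tendsto_natCast_div_exp_rank hw hle hfin hcount).congr fun r => ?_
    rw [hprob, mul_div_cancel_left₀ _ hC.ne', prod_map_eq_exp_sum_log hq, ← Real.exp_mul,
      div_eq_mul_inv, ← Real.exp_neg, hcost]
    ring_nf

/-! ### The exponent -/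

theorem strictAnti_sum_rpow {ι : Type*} [Fintype ι] [Nonempty ι] {q : ι → ℝ} (hq : ∀ i, 0 < q i)
    (hq1 : ∀ i, q i < 1) : StrictAnti fun γ : ℝ => ∑ i, q i ^ γ := fun _ _ hxy =>
  Finset.sum_lt_sum_of_nonempty Finset.univ_nonempty fun i _ =>
    Real.rpow_lt_rpow_of_exponent_gt (hq i) (hq1 i) hxy

theorem exists_sum_rpow_eq_one {ι : Type*} [Fintype ι] [Nonempty ι] {q : ι → ℝ}
    (hq : ∀ i, 0 < q i) (hsum : ∑ i, q i ≤ 1) : ∃ γ : ℝ, ∑ i, q i ^ γ = 1 := by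
  have hc : Continuous fun γ : ℝ => ∑ i, q i ^ γ :=
    continuous_finsetSum _ fun i _ => Real.continuous_const_rpow (hq i).ne'
  obtain ⟨γ, -, hγ⟩ := intermediate_value_Icc' zero_le_one hc.continuousOn
    (show (1 : ℝ) ∈ Set.Icc _ _ from ⟨by simpa using hsum, by
      simpa using (Nat.one_le_iff_ne_zero.2 Fintype.card_ne_zero : 1 ≤ Fintype.card ι)⟩)
  exact ⟨γ, hγ⟩

end Monkey

theorem theorem1 (n : ℕ) :
    -- words with a stop symbol: `p 0` is its probability, `p i.succ` are those of the letters
    (∀ p : Fin (n + 1) → ℝ, (∀ i, 0 < p i) → ∑ i, p i = 1 →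
      (∃ i j : Fin n, Irrational (Real.log (p i.succ) / Real.log (p j.succ))) →
      (∃! γ : ℝ, ∑ i : Fin n, p i.succ ^ γ = 1) ∧
      (∃ w, Monkey.IsRanking (fun u : List (Fin n) => Monkey.seqProb p (Monkey.withStop u)) w) ∧
      ∀ γ : ℝ, ∑ i : Fin n, p i.succ ^ γ = 1 →
        0 < γ ∧ γ < 1 ∧
        Monkey.entropy (fun i : Fin n => p i.succ ^ γ)
          = -γ * ∑ i : Fin n, p i.succ ^ γ * Real.log (p i.succ) ∧
        0 < Monkey.entropy (fun i : Fin n => p i.succ ^ γ) ∧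
        ∀ w, Monkey.IsRanking
            (fun u : List (Fin n) => Monkey.seqProb p (Monkey.withStop u)) w →
          Tendsto (fun r : ℕ =>
              (Monkey.seqProb p (Monkey.withStop (w r)) / p 0) ^ (-γ) / (r : ℝ)) atTop
            (𝓝 (Monkey.entropy (fun i : Fin n => p i.succ ^ γ))) ∧
          Tendsto (fun r : ℕ =>
              Monkey.seqProb p (Monkey.withStop (w r)) / (r : ℝ) ^ (-1 / γ)) atTop
            (𝓝 (p 0 * Monkey.entropy (fun i : Fin n => p i.succ ^ γ) ^ (-1 / γ)))) ∧
    -- the case `γ = 1`: all finite words, no stop symbol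
    (∀ p : Fin n → ℝ, (∀ i, 0 < p i) → ∑ i, p i = 1 →
      (∃ i j, Irrational (Real.log (p i) / Real.log (p j))) →
      0 < Monkey.entropy p ∧
      (∃ w, Monkey.IsRanking (Monkey.seqProb p) w) ∧
      ∀ w, Monkey.IsRanking (Monkey.seqProb p) w →
        Tendsto (fun r : ℕ => Monkey.seqProb p (w r) / (r : ℝ)⁻¹) atTop
          (𝓝 (Monkey.entropy p)⁻¹)) ∧
    -- the multinomial form
    (∀ a : Fin n → ℝ, (∀ i, 0 < a i) → (∃ i j, Irrational (a i / a j)) →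
      ∑ i, Real.exp (-a i) = 1 →
      Tendsto (fun z : ℝ => Monkey.multinomialSum a z / Real.exp z) atTop
        (𝓝 (∑ i, a i * Real.exp (-a i))⁻¹)) := by
  refine ⟨fun p hp hp1 hirr => ?_, fun p hp hp1 hirr => ?_, fun a ha hirr h1 => ?_⟩
  · obtain ⟨i, j, hij⟩ := id hirr
    have hne : i ≠ j := Monkey.ne_of_irrational_div (x := fun i : Fin n => Real.log (p i.succ)) hij
    have : Nontrivial (Fin n) := ⟨i, j, hne⟩
    have : Nontrivial (Fin (n + 1)) := ⟨0, i.succ, (Fin.succ_ne_zero i).symm⟩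
    have hq : ∀ i : Fin n, 0 < p i.succ := fun i => hp i.succ
    have hq1 : ∀ i : Fin n, p i.succ < 1 := fun i => Monkey.lt_one_of_sum_eq_one hp hp1 i.succ
    have hlt : ∑ i : Fin n, p i.succ < 1 := by
      rw [Fin.sum_univ_succ] at hp1
      have := hp 0
      linarith
    have hanti := Monkey.strictAnti_sum_rpow hq hq1
    have hprob : ∀ u : List (Fin n), Monkey.seqProb p (Monkey.withStop u)
        = p 0 * (u.map fun i => p i.succ).prod := fun u => by
      simp [Monkey.seqProb, Monkey.withStop, Function.comp_def, mul_comm]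
    have hpos : ∀ γ : ℝ, ∑ i : Fin n, p i.succ ^ γ = 1 → 0 < γ := fun γ hγ =>
      hanti.lt_iff_gt.1 (by
        have : 1 < Fintype.card (Fin n) := Fintype.one_lt_card
        simp only [hγ, Real.rpow_zero, Finset.sum_const, Finset.card_univ, nsmul_eq_mul, mul_one]
        exact_mod_cast this)
    obtain ⟨γ₀, hγ₀⟩ := Monkey.exists_sum_rpow_eq_one hq hlt.le
    refine ⟨⟨γ₀, hγ₀, fun γ hγ => hanti.injective (hγ.trans hγ₀.symm)⟩,
      (Monkey.ranking_of_prob_eq hq hq1 hirr (hpos γ₀ hγ₀) hγ₀ (hp 0) hprob).1,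
      fun γ hγ => ?_⟩
    have hγ0 := hpos γ hγ
    have hH : 0 < Monkey.entropy (fun i : Fin n => p i.succ ^ γ) :=
      Monkey.entropy_pos (fun i => Real.rpow_pos_of_pos (hq i) γ)
        fun i => Real.rpow_lt_one (hq i).le (hq1 i) hγ0
    refine ⟨hγ0, hanti.lt_iff_gt.1 (by simpa [hγ] using hlt), Monkey.entropy_rpow hq γ, hH,
      fun w hw => ?_⟩
    have hlim := (Monkey.ranking_of_prob_eq hq hq1 hirr hγ0 hγ (hp 0) hprob).2 w hw
    have hx : ∀ u : List (Fin n), 0 < Monkey.seqProb p (Monkey.withStop u) / p 0 := fun u => by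
      rw [hprob, mul_div_cancel_left₀ _ (hp 0).ne', Monkey.prod_map_eq_exp_sum_log hq]
      exact Real.exp_pos _
    constructor
    · have := hlim.inv₀ (inv_ne_zero hH.ne')
      rw [inv_inv] at this
      refine this.congr fun r => ?_
      rw [mul_inv, mul_comm, Real.rpow_neg (hx _).le, ← div_eq_mul_inv]
    · have := (hlim.rpow_const (p := 1 / γ) (.inl (inv_ne_zero hH.ne'))).const_mul (p 0)
      rw [Real.inv_rpow hH.le, ← Real.rpow_neg hH.le, ← neg_div] at this
      refine this.congr fun r => ?_
      rw [Real.mul_rpow (Nat.cast_nonneg r) (Real.rpow_nonneg (hx _).le _),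
        ← Real.rpow_mul (hx _).le, mul_one_div_cancel hγ0.ne', Real.rpow_one, neg_div,
        Real.rpow_neg (Nat.cast_nonneg r), div_inv_eq_mul, mul_left_comm,
        mul_div_cancel₀ _ (hp 0).ne', mul_comm]
  · obtain ⟨i, j, hij⟩ := id hirr
    have hne : i ≠ j := Monkey.ne_of_irrational_div (x := fun i => Real.log (p i)) hij
    have : Nontrivial (Fin n) := ⟨i, j, hne⟩
    have hlt := Monkey.lt_one_of_sum_eq_one hp hp1
    obtain ⟨hex, hlim⟩ := Monkey.ranking_of_prob_eq hp hlt hirr one_pos (by simpa using hp1)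
      one_pos (prob := Monkey.seqProb p) fun u => (one_mul _).symm
    refine ⟨Monkey.entropy_pos hp hlt, hex, fun w hw => ?_⟩
    simpa [mul_comm] using hlim w hw
  · simpa only [Monkey.multinomialSum_eq_wordCount ha] using
      Monkey.tendsto_wordCount ha hirr h1
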